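/- For $n\ge 0$ let $[n]=\{1,\dots,n\}$ (with $[0]=\emptyset$). A Cayley permutation of $[n]$ is a map $w:[n]\to[n]$ whose image is $[k]$ for some $k\le n$; let $\mathrm{Cay}[n]$ be the set of all of them. Let $\mathrm{des}(w)=|\{i\in[n-1]: w(i)\ge w(i+1)\}|$ be the number of weak descents of $w$ (so $\mathrm{des}(w)=0$ for $n\le 1$), and let $$C_n(t)=\sum_{w\in \mathrm{Cay}[n]}t^{\mathrm{des}(w)}$$ be the $n$-th (weak) Caylerian polynomial. Then, for every $n\ge 0$, $$C_n(t)=\frac{1}{n!}\sum_{k=0}^{n}\begin{bmatrix}n\\k\end{bmatrix}\mathrm{fub}(k)\sum_{i=0}^{k}\begin{Bmatrix}k\\i\end{Bmatrix}\,i!\,(t-1)^{n-i}$$ as polynomials in $t$ with rational coefficients. Here $\begin{bmatrix}n\\k\end{bmatrix}$ is the unsigned Stirling number of the first kind (the number of permutations of $[n]$ with $k$ cycles), $\begin{Bmatrix}k\\i\end{Bmatrix}$ is the Stirling number of the second kind (the number of set partitions of $[k]$ into $i$ blocks), and $\mathrm{fub}(k)$ is the $k$-th Fubini number, i.e. the number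 of ballots (ordered set partitions) of $[k]$: lists of pairwise disjoint nonempty sets with union $[k]$. -/

import Mathlib

namespace Caylerian

/-- A Cayley permutation of `[n]`: a map `w : [n] → [n]` whose image is `[k]` for some `k ≤ n`.
Both copies of `[n] = {1, …, n}` are shifted by one and modelled by `Fin n = {0, …, n - 1}`, so that
`[k]` becomes `{j | j < k}`. -/
def IsCayley {n : ℕ} (w : Fin n → Fin n) : Prop :=
  ∃ k : ℕ, k ≤ n ∧ Finset.univ.image w = Finset.univ.filter (fun j : Fin n => j.val < k)

instance {n : ℕ} : DecidablePred (IsCayley (n := n)) := fun w =>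
  inferInstanceAs (Decidable (∃ k : ℕ, k ≤ n ∧
    Finset.univ.image w = Finset.univ.filter (fun j : Fin n => j.val < k)))

/-- The set of Cayley permutations of `[n]`. -/
def cay (n : ℕ) : Finset (Fin n → Fin n) :=
  Finset.univ.filter IsCayley

/-- The set of weak descents of `w`: positions `i` that have a successor `i + 1` and satisfy
`w (i) ≥ w (i + 1)`. -/
def desSet {n : ℕ} (w : Fin n → Fin n) : Finset (Fin n) :=
  Finset.univ.filter (fun i => ∃ h : i.val + 1 < n, w i ≥ w ⟨i.val + 1, h⟩)

/-- The number of weak descents. -/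
def des {n : ℕ} (w : Fin n → Fin n) : ℕ :=
  (desSet w).card

/-- The `n`-th (weak) Caylerian polynomial. -/
noncomputable def caylerianPoly (n : ℕ) : Polynomial ℚ :=
  ∑ w ∈ cay n, Polynomial.X ^ des w

/-- A ballot (ordered set partition) of `[n]`: a list of pairwise disjoint nonempty blocks whose
union is `[n]`. -/
def IsBallot {n : ℕ} (l : List (Finset (Fin n))) : Prop :=
  (∀ B ∈ l, B.Nonempty) ∧ l.Pairwise Disjoint ∧ ∀ x : Fin n, ∃ B ∈ l, x ∈ B

/-- The `n`-th Fubini number: the number of ballots of `[n]`. -/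
noncomputable def fub (n : ℕ) : ℕ :=
  {l : List (Finset (Fin n)) | IsBallot l}.ncard

/-- There are finitely many ballots, so `fub` is a genuine count. -/
theorem finite_ballots (n : ℕ) : {l : List (Finset (Fin n)) | IsBallot l}.Finite := by
  refine Set.Finite.subset (List.finite_length_le (Finset (Fin n))
    (Fintype.card (Finset (Fin n)))) ?_
  rintro l ⟨hne, hd, -⟩
  refine List.Nodup.length_le_card (List.Pairwise.imp_of_mem ?_ hd)
  rintro a b ha - hab rfl
  exact (hne a ha).ne_empty (disjoint_self.mp hab)

end Caylerian

/-!
Let `W b n` enumerate by weak descents, at a parameter `t`, the words of length `n` over `b`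
letters. Expanding `t = 1 + (t - 1)` at every weak descent cuts a word into `i` nonempty weakly
decreasing runs, at the price of a factor `(t - 1) ^ (n - i)`. Since a weakly decreasing word is a
multiset of letters,
`W b n = ∑ i, [Xⁿ] ((1 - X)⁻ᵇ - 1) ^ i * (t - 1) ^ (n - i)`.

On the one hand
`∑ i, choose a i * [Xⁿ] ((1 - X)⁻ᵇ - 1) ^ i = [Xⁿ] (1 - X)^(-ab)`, and `n!` times this is
`(ab) (ab + 1) ⋯ (ab + n - 1) = ∑ k, stirlingFirst n k * (ab) ^ k`. On the other hand
`a ^ k = ∑ i, choose a i * (i! * stirlingSecond k i)`. Binomial inversion in `a` therefore exhibits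
`n! * W b n` as a polynomial in `b`.

A Cayley permutation with image `[m]` is a surjective word over `m` letters. Sorting words by the
set of letters they use shows that the enumerators of the surjective words are the binomial inverse
of `W b n` in `b`, which replaces each `b ^ k` by `m! * stirlingSecond k m`, the number of ballots
of `[k]` with `m` blocks. Summing over `m` turns this number into `fub k`.
-/

namespace Caylerian

open Finset Function Matrix

section StirlingNumbers

theorem eq_of_sum_choose_nsmul_eq {M : Type*} [AddCancelCommMonoid M] {f g : ℕ → M}
    (h : ∀ b, ∑ m ∈ range (b + 1), b.choose m • f m = ∑ m ∈ range (b + 1), b.choose m • g m)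
    (m : ℕ) : f m = g m := by
  induction m using Nat.strong_induction_on with
  | _ m ih =>
    have hm := h m
    rw [sum_range_succ, sum_range_succ,
      sum_congr rfl fun i hi => by rw [ih i (mem_range.mp hi)]] at hm
    simpa using hm

theorem sum_descFactorial_mul_stirlingSecond (a k : ℕ) :
    ∑ i ∈ range (a + 1), a.descFactorial i * k.stirlingSecond i = a ^ k := by
  induction k with
  | zero => simp [sum_range_succ']
  | succ k ih =>
    calc ∑ i ∈ range (a + 1), a.descFactorial i * (k + 1).stirlingSecond i
      _ = ∑ i ∈ range a, (i + 1) * (a.descFactorial (i + 1) * k.stirlingSecond (i + 1)) +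
          ∑ i ∈ range a, (a - i) * (a.descFactorial i * k.stirlingSecond i) := by
        rw [sum_range_succ', Nat.stirlingSecond_succ_zero, mul_zero, add_zero, ← sum_add_distrib]
        refine sum_congr rfl fun i _ => ?_
        rw [Nat.stirlingSecond_succ_succ, mul_add, Nat.descFactorial_succ]
        ring
      _ = ∑ i ∈ range (a + 1), i * (a.descFactorial i * k.stirlingSecond i) +
          ∑ i ∈ range (a + 1), (a - i) * (a.descFactorial i * k.stirlingSecond i) := by
        rw [sum_range_succ' _ a, sum_range_succ _ a, Nat.sub_self, zero_mul, zero_mul, add_zero,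
          add_zero]
      _ = a ^ (k + 1) := by
        rw [← sum_add_distrib, pow_succ', ← ih, mul_sum]
        refine sum_congr rfl fun i hi => ?_
        rw [← add_mul, Nat.add_sub_cancel' (mem_range_succ_iff.mp hi)]

theorem sum_choose_mul_factorial_mul_stirlingSecond (a k : ℕ) :
    ∑ i ∈ range (a + 1), a.choose i * (i.factorial * k.stirlingSecond i) = a ^ k := by
  rw [← sum_descFactorial_mul_stirlingSecond]
  refine sum_congr rfl fun i _ => ?_
  rw [Nat.descFactorial_eq_factorial_mul_choose]
  ring

theorem sum_stirlingSecond_mul_of_le {R : Type*} [Semiring R] {k n : ℕ} (h : k ≤ n) (f : ℕ → R) :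
    ∑ i ∈ range (n + 1), (k.stirlingSecond i : R) * f i =
      ∑ i ∈ range (k + 1), (k.stirlingSecond i : R) * f i := by
  refine (sum_subset (range_mono (by lia)) fun i _ hi => ?_).symm
  rw [Nat.stirlingSecond_eq_zero_of_lt (by simpa using hi), Nat.cast_zero, zero_mul]

theorem coeff_ascPochhammer {R : Type*} [Semiring R] (n k : ℕ) :
    (ascPochhammer R n).coeff k = n.stirlingFirst k := by
  induction n generalizing k with
  | zero => cases k <;> simp [Polynomial.coeff_one]
  | succ n ih =>
    rw [ascPochhammer_succ_right, mul_add, Polynomial.coeff_add, ← Polynomial.C_eq_natCast,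
      Polynomial.coeff_mul_C, ih]
    cases k with
    | zero => cases n <;> simp
    | succ k =>
      rw [Polynomial.coeff_mul_X, ih, Nat.stirlingFirst_succ_succ, Nat.cast_add, Nat.cast_mul,
        Nat.cast_comm, add_comm]

theorem sum_stirlingFirst_mul_pow (x n : ℕ) :
    ∑ k ∈ range (n + 1), n.stirlingFirst k * x ^ k = x.ascFactorial n := by
  rw [← ascPochhammer_nat_eq_ascFactorial, Polynomial.eval_eq_sum_range, ascPochhammer_natDegree]
  simp only [coeff_ascPochhammer, Nat.cast_id]

end StirlingNumbers

section SurjectiveWords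

variable {ι : Type*} [Fintype ι] [DecidableEq ι]

theorem sum_image_eq_sum_surjective {M : Type*} [AddCommMonoid M] {f : ∀ m, (ι → Fin m) → M}
    (hf : ∀ m b (e : Fin m ↪o Fin b) w, f b (e ∘ w) = f m w) {b : ℕ} (T : Finset (Fin b)) :
    ∑ w with univ.image w = T, f b w = ∑ w with Surjective w, f #T w := by
  set e := T.orderEmbOfFin rfl
  have image_comp (w : ι → Fin #T) : univ.image (e ∘ w) = T ↔ Surjective w := by
    have range_e : Set.range e = T := range_orderEmbOfFin T rfl
    rw [← coe_inj, coe_image, coe_univ, Set.image_univ, Set.range_comp, ← range_e,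
      ← Set.image_univ (f := e), e.injective.image_injective.eq_iff, Set.range_eq_univ]
  symm
  refine sum_nbij (e ∘ ·) ?_ e.injective.comp_left.injOn ?_ fun w _ => (hf _ _ e w).symm
  · simp [image_comp]
  · intro w hw
    have hw : univ.image w = T := by simpa using hw
    have exists_eq (x : ι) : ∃ j, e j = w x := by
      rw [← Set.mem_range, range_orderEmbOfFin, ← hw]
      simp
    choose v hv using exists_eq
    obtain rfl : e ∘ v = w := funext hv
    exact ⟨v, by simpa using (image_comp v).mp hw, rfl⟩

theorem sum_words_eq_sum_choose_nsmul {M : Type*} [AddCommMonoid M] {f : ∀ m, (ι → Fin m) → M}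
    (hf : ∀ m b (e : Fin m ↪o Fin b) w, f b (e ∘ w) = f m w) (b : ℕ) :
    ∑ w, f b w = ∑ m ∈ range (b + 1), b.choose m • ∑ w with Surjective w, f m w := by
  rw [← sum_fiberwise univ fun w : ι → Fin b => univ.image w]
  simp_rw [sum_image_eq_sum_surjective hf]
  rw [← powerset_univ, sum_powerset_apply_card fun m => ∑ w with Surjective w, f m w,
    card_univ, Fintype.card_fin]

theorem card_surjective_fin (m : ℕ) :
    #{w : ι → Fin m | Surjective w} = m.factorial * (Fintype.card ι).stirlingSecond m := by
  revert m
  refine eq_of_sum_choose_nsmul_eq fun b => ?_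
  have card_words := sum_words_eq_sum_choose_nsmul (ι := ι) (f := fun _ _ => 1)
    (fun _ _ _ _ => rfl) b
  simp only [smul_eq_mul, ← card_eq_sum_ones] at card_words ⊢
  rw [← card_words, sum_choose_mul_factorial_mul_stirlingSecond, card_univ, Fintype.card_fun,
    Fintype.card_fin]

end SurjectiveWords

section Ballots

variable {k : ℕ}

/-- The list of the fibres of `w`, in the order of the letters. On surjective words it is the
correspondence with ballots. -/
def fibreList {m : ℕ} (w : Fin k → Fin m) : List (Finset (Fin k)) :=
  List.ofFn fun j => univ.filter fun x => w x = j

theorem fibreList_injective :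
    Injective fun p : Σ m, Fin k → Fin m => fibreList p.2 := by
  rintro ⟨m, w⟩ ⟨m', w'⟩ h
  obtain rfl : m = m' := by simpa [fibreList] using congrArg List.length h
  have fibre_eq := List.ofFn_injective h
  congr
  funext x
  have hx : x ∈ ({y | w y = w x} : Finset (Fin k)) := by simp
  rw [congrFun fibre_eq (w x)] at hx
  exact (mem_filter.mp hx).2.symm

theorem isBallot_fibreList {m : ℕ} {w : Fin k → Fin m} (hw : Surjective w) :
    IsBallot (fibreList w) := by
  refine ⟨?_, ?_, fun x => ?_⟩
  · simpa [fibreList, List.forall_mem_ofFn_iff, Finset.Nonempty, Surjective] using hw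
  · rw [fibreList, List.pairwise_ofFn]
    exact fun i j hij => disjoint_filter.mpr fun x _ hi hj => hij.ne (hi.symm.trans hj)
  · exact ⟨_, (List.mem_ofFn' _ _).mpr ⟨w x, rfl⟩, by simp⟩

theorem exists_fibreList_eq {l : List (Finset (Fin k))} (hl : IsBallot l) :
    ∃ w : Fin k → Fin l.length, Surjective w ∧ fibreList w = l := by
  obtain ⟨nonempty, disjoint, covers⟩ := hl
  have exists_block (x : Fin k) : ∃ j : Fin l.length, x ∈ l.get j := by
    obtain ⟨B, hB, hx⟩ := covers x
    obtain ⟨j, rfl⟩ := List.mem_iff_get.mp hB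
    exact ⟨j, hx⟩
  choose w hw using exists_block
  have mem_block_iff (x : Fin k) (j : Fin l.length) : x ∈ l.get j ↔ w x = j := by
    refine ⟨fun hx => ?_, fun h => h ▸ hw x⟩
    by_contra hne
    rw [List.pairwise_iff_get] at disjoint
    rcases lt_or_gt_of_ne hne with hlt | hlt
    · exact disjoint_left.mp (disjoint _ _ hlt) (hw x) hx
    · exact disjoint_left.mp (disjoint _ _ hlt) hx (hw x)
  refine ⟨w, fun j => ?_, ?_⟩
  · obtain ⟨x, hx⟩ := nonempty _ (List.get_mem l j)
    exact ⟨x, (mem_block_iff x j).mp hx⟩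
  · conv_rhs => rw [← List.ofFn_get l]
    simp only [fibreList, ← mem_block_iff, filter_univ_mem]

theorem fub_eq_sum (k : ℕ) :
    fub k = ∑ m ∈ range (k + 1), k.stirlingSecond m * m.factorial := by
  have setOf_isBallot : {l : List (Finset (Fin k)) | IsBallot l} =
      (((range (k + 1)).sigma fun m => {w : Fin k → Fin m | Surjective w}).map
        ⟨_, fibreList_injective⟩ : Finset (List (Finset (Fin k)))) := by
    ext l
    simp only [Set.mem_ofPred_eq, coe_map, Set.mem_image, mem_coe, mem_sigma, mem_range_succ_iff,
      mem_filter_univ, Embedding.coeFn_mk, Sigma.exists]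
    constructor
    · intro hl
      obtain ⟨w, hw, hwl⟩ := exists_fibreList_eq hl
      exact ⟨_, w, ⟨by simpa using Fintype.card_le_of_surjective w hw, hw⟩, hwl⟩
    · rintro ⟨m, w, ⟨-, hw⟩, rfl⟩
      exact isBallot_fibreList hw
  rw [fub, setOf_isBallot, Set.ncard_coe_finset, card_map, card_sigma]
  simp_rw [card_surjective_fin, Fintype.card_fin, mul_comm]

theorem sum_factorial_mul_stirlingSecond_eq_fub {n : ℕ} (h : k ≤ n) :
    ∑ m ∈ range (n + 1), m.factorial * k.stirlingSecond m = fub k := by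
  rw [fub_eq_sum]
  simpa only [Nat.cast_id, mul_comm] using sum_stirlingSecond_mul_of_le h Nat.factorial

end Ballots

section WeakDescents

variable {α β : Type*} {n : ℕ}

/-- The number of weak descents of a word over an arbitrary alphabet, extending `des` to words whose
alphabet is not indexed by their positions. -/
def wordDes [LE α] [DecidableLE α] (w : Fin n → α) : ℕ :=
  #{i : Fin n | ∃ h : i.val + 1 < n, w ⟨i.val + 1, h⟩ ≤ w i}

theorem des_eq_wordDes (w : Fin n → Fin n) : des w = wordDes w := by
  simp [des, desSet, wordDes]

theorem wordDes_comp [LE α] [DecidableLE α] [LE β] [DecidableLE β] (e : α ↪o β) (w : Fin n → α) :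
    wordDes (e ∘ w) = wordDes w := by
  simp [wordDes, e.map_rel_iff]

theorem wordDes_of_le_one [LE α] [DecidableLE α] (hn : n ≤ 1) (w : Fin n → α) :
    wordDes w = 0 := by
  rw [wordDes, card_eq_zero, filter_eq_empty_iff]
  rintro i - ⟨h, -⟩
  lia

theorem wordDes_vecCons_vecCons [LE α] [DecidableLE α] (v u : α) (w : Fin n → α) :
    wordDes (vecCons v (vecCons u w)) = (if u ≤ v then 1 else 0) + wordDes (vecCons u w) := by
  simp only [wordDes, card_filter]
  rw [Fin.sum_univ_succ]
  congr 1
  · simp [Fin.mk_one]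
  · simp

theorem sum_fun_fin_succ {M : Type*} [AddCommMonoid M] [Fintype α] (f : (Fin (n + 1) → α) → M) :
    ∑ w, f w = ∑ v, ∑ w : Fin n → α, f (vecCons v w) := by
  rw [← Fintype.sum_prod_type']
  exact (Fintype.sum_equiv (Fin.consEquiv fun _ => α) _ _ fun _ => rfl).symm

end WeakDescents

section WordEnumerator

variable {R : Type*} [CommRing R] (t : R)

/-- The weak descent enumerator, evaluated at `t`, of the words of length `n` over `Fin b`. -/
def wordEnumerator (b n : ℕ) : R :=
  ∑ w : Fin n → Fin b, t ^ wordDes w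

/-- The part of `wordEnumerator t b (n + 1)` contributed by the words with first letter `v`. -/
def wordEnumeratorFrom {b : ℕ} (n : ℕ) (v : Fin b) : R :=
  ∑ w : Fin n → Fin b, t ^ wordDes (vecCons v w)

theorem wordEnumerator_zero (b : ℕ) : wordEnumerator t b 0 = 1 := by
  simp [wordEnumerator, wordDes_of_le_one]

theorem wordEnumerator_succ (b n : ℕ) :
    wordEnumerator t b (n + 1) = ∑ v : Fin b, wordEnumeratorFrom t n v :=
  sum_fun_fin_succ _

theorem wordEnumeratorFrom_zero {b : ℕ} (v : Fin b) : wordEnumeratorFrom t 0 v = 1 := by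
  simp [wordEnumeratorFrom, wordDes_of_le_one]

theorem wordEnumeratorFrom_succ {b : ℕ} (n : ℕ) (v : Fin b) :
    wordEnumeratorFrom t (n + 1) v =
      wordEnumerator t b (n + 1) + (t - 1) * ∑ u ∈ Iic v, wordEnumeratorFrom t n u := by
  rw [wordEnumeratorFrom, sum_fun_fin_succ, wordEnumerator_succ, mul_sum,
    ← filter_ge_eq_Iic, sum_filter, ← sum_add_distrib]
  refine sum_congr rfl fun u _ => ?_
  simp_rw [wordDes_vecCons_vecCons, pow_add, ← mul_sum]
  rw [← wordEnumeratorFrom]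
  split_ifs <;> ring

theorem sum_range_multichoose_sub (b j : ℕ) :
    ∑ i ∈ range b, (b - i).multichoose j = b.multichoose (j + 1) := by
  induction b with
  | zero => simp
  | succ b ih => simp [sum_range_succ', ih, Nat.multichoose_succ_succ]

theorem sum_multichoose_sub (b j : ℕ) :
    ∑ v : Fin b, (b - v : ℕ).multichoose j = b.multichoose (j + 1) := by
  rw [Fin.sum_univ_eq_sum_range fun i => (b - i).multichoose j, sum_range_multichoose_sub]

theorem sum_Ici_multichoose_sub {b : ℕ} (u : Fin b) (j : ℕ) :
    ∑ v ∈ Ici u, (b - v : ℕ).multichoose j = (b - u : ℕ).multichoose (j + 1) := by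
  calc ∑ v ∈ Ici u, (b - v : ℕ).multichoose j
    _ = ∑ i ∈ Ico u.val b, (b - i).multichoose j := by
      rw [← Fin.map_valEmbedding_Ici, sum_map]
      rfl
    _ = (b - u : ℕ).multichoose (j + 1) := by
      rw [sum_Ico_eq_sum_range, ← sum_range_multichoose_sub]
      simp only [Nat.sub_add_eq]

-- `(b - v).multichoose j` counts the weakly decreasing words of length `j` with letters `≥ v`.
-- Prepending them, the left side enumerates words that begin with a weakly decreasing run of
-- length `j + 1` whose descents carry no weight. Writing `t = 1 + (t - 1)`, the run continues
-- through `i` further descents weighted `t - 1` and stops at one weighted `1`.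
theorem sum_multichoose_mul_wordEnumeratorFrom (b j n : ℕ) :
    ∑ v : Fin b, ((b - v : ℕ).multichoose j : R) * wordEnumeratorFrom t n v =
      ∑ i ∈ range (n + 1),
        (t - 1) ^ i * b.multichoose (j + i + 1) * wordEnumerator t b (n - i) := by
  induction n generalizing j with
  | zero => simp [wordEnumeratorFrom_zero, wordEnumerator_zero, ← sum_multichoose_sub]
  | succ n ih =>
    have extend_run :
        ∑ v : Fin b, ((b - v : ℕ).multichoose j : R) * ∑ u ∈ Iic v, wordEnumeratorFrom t n u =
          ∑ u : Fin b, ((b - u : ℕ).multichoose (j + 1) : R) * wordEnumeratorFrom t n u := by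
      simp_rw [← sum_Ici_multichoose_sub, Nat.cast_sum, mul_sum, sum_mul]
      exact sum_comm' (by simp)
    calc ∑ v : Fin b, ((b - v : ℕ).multichoose j : R) * wordEnumeratorFrom t (n + 1) v
      _ = (t - 1) * ∑ u : Fin b, ((b - u : ℕ).multichoose (j + 1) : R) *
            wordEnumeratorFrom t n u + b.multichoose (j + 1) * wordEnumerator t b (n + 1) := by
        simp_rw [wordEnumeratorFrom_succ, mul_add, sum_add_distrib, mul_left_comm _ (t - 1)]
        rw [← mul_sum, extend_run, ← sum_mul, ← Nat.cast_sum, sum_multichoose_sub, add_comm]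
      _ = _ := by
        rw [ih, sum_range_succ' _ (n + 1), mul_sum]
        congr 1
        · refine sum_congr rfl fun i _ => ?_
          rw [Nat.add_sub_add_right, pow_succ', add_right_comm j 1 i, ← add_assoc j i 1]
          ring
        · simp

theorem wordEnumerator_succ_eq_sum (b n : ℕ) :
    wordEnumerator t b (n + 1) = ∑ i ∈ range (n + 1),
      (t - 1) ^ i * b.multichoose (i + 1) * wordEnumerator t b (n - i) := by
  simpa [wordEnumerator_succ] using sum_multichoose_mul_wordEnumeratorFrom t b 0 n

end WordEnumerator

section PowerSeries

variable (R : Type*) [CommRing R]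

theorem coeff_invOneSubPow (b n : ℕ) :
    PowerSeries.coeff n (PowerSeries.invOneSubPow R b).val = b.multichoose n := by
  cases b with
  | zero => cases n <;> simp [PowerSeries.invOneSubPow_zero, PowerSeries.coeff_one]
  | succ b =>
    rw [PowerSeries.invOneSubPow_val_succ_eq_mk_add_choose, PowerSeries.coeff_mk,
      Nat.multichoose_eq, Nat.choose_symm_add, Nat.add_right_comm, Nat.add_sub_cancel]

theorem invOneSubPow_pow (b a : ℕ) :
    PowerSeries.invOneSubPow R b ^ a = PowerSeries.invOneSubPow R (a * b) := by
  simp_rw [PowerSeries.invOneSubPow_eq_inv_one_sub_pow, ← pow_mul']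

/-- The generating series `(1 - X)⁻ᵇ - 1` of the nonempty multisets on `b` letters, that is, of the
nonempty weakly decreasing words over `Fin b`. -/
noncomputable def multisetSeries (b : ℕ) : PowerSeries R :=
  (PowerSeries.invOneSubPow R b).val - 1

theorem coeff_zero_multisetSeries (b : ℕ) : PowerSeries.coeff 0 (multisetSeries R b) = 0 := by
  rw [multisetSeries, map_sub, coeff_invOneSubPow, Nat.multichoose_zero_right]
  simp

theorem coeff_succ_multisetSeries (b j : ℕ) :
    PowerSeries.coeff (j + 1) (multisetSeries R b) = b.multichoose (j + 1) := by
  rw [multisetSeries, map_sub, coeff_invOneSubPow]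
  simp [PowerSeries.coeff_one]

theorem coeff_multisetSeries_pow_of_lt {b n i : ℕ} (h : n < i) :
    PowerSeries.coeff n (multisetSeries R b ^ i) = 0 := by
  have X_dvd : PowerSeries.X ∣ multisetSeries R b := by
    rw [PowerSeries.X_dvd_iff, ← PowerSeries.coeff_zero_eq_constantCoeff_apply,
      coeff_zero_multisetSeries]
  exact PowerSeries.X_pow_dvd_iff.mp (pow_dvd_pow_of_dvd X_dvd i) n h

theorem coeff_succ_multisetSeries_pow_succ (b n i : ℕ) :
    PowerSeries.coeff (n + 1) (multisetSeries R b ^ (i + 1)) =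
      ∑ j ∈ range (n + 1),
        (b.multichoose (j + 1) : R) * PowerSeries.coeff (n - j) (multisetSeries R b ^ i) := by
  rw [pow_succ', PowerSeries.coeff_mul, Nat.sum_antidiagonal_succ, coeff_zero_multisetSeries,
    zero_mul, zero_add, Nat.sum_antidiagonal_eq_sum_range_succ_mk]
  simp_rw [coeff_succ_multisetSeries]

theorem sum_choose_nsmul_coeff_multisetSeries_pow (a b n : ℕ) :
    ∑ i ∈ range (a + 1), a.choose i • PowerSeries.coeff n (multisetSeries R b ^ i) =
      ((a * b).multichoose n : R) := by
  rw [← coeff_invOneSubPow R, ← invOneSubPow_pow, Units.val_pow_eq_pow_val,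
    ← sub_add_cancel (PowerSeries.invOneSubPow R b).val 1, ← multisetSeries, add_pow, map_sum]
  refine sum_congr rfl fun i _ => ?_
  rw [one_pow, mul_one, ← nsmul_eq_mul', map_nsmul]

theorem factorial_mul_coeff_multisetSeries_pow (b n i : ℕ) :
    (n.factorial : R) * PowerSeries.coeff n (multisetSeries R b ^ i) =
      ∑ k ∈ range (n + 1),
        ((n.stirlingFirst k * b ^ k * (i.factorial * k.stirlingSecond i) : ℕ) : R) := by
  revert i
  refine eq_of_sum_choose_nsmul_eq fun a => ?_
  simp_rw [← mul_smul_comm]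
  rw [← mul_sum, sum_choose_nsmul_coeff_multisetSeries_pow, Nat.multichoose_eq, ← Nat.cast_mul,
    ← Nat.ascFactorial_eq_factorial_mul_choose', ← sum_stirlingFirst_mul_pow, Nat.cast_sum]
  simp_rw [smul_sum]
  rw [sum_comm]
  refine sum_congr rfl fun k _ => ?_
  rw [mul_pow, ← sum_choose_mul_factorial_mul_stirlingSecond a k]
  push_cast
  rw [sum_mul, mul_sum]
  exact sum_congr rfl fun i _ => by ring

end PowerSeries

section CaylerianEnumerator

variable {R : Type*} [CommRing R] (t : R)

theorem wordEnumerator_eq_sum_coeff (b n : ℕ) :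
    wordEnumerator t b n = ∑ i ∈ range (n + 1),
      PowerSeries.coeff n (multisetSeries R b ^ i) * (t - 1) ^ (n - i) := by
  induction n using Nat.strong_induction_on with
  | _ n ih =>
    cases n with
    | zero => simp [wordEnumerator_zero]
    | succ n =>
      rw [wordEnumerator_succ_eq_sum, sum_range_succ' _ (n + 1), pow_zero, PowerSeries.coeff_one,
        if_neg n.succ_ne_zero, zero_mul, add_zero]
      simp_rw [coeff_succ_multisetSeries_pow_succ, sum_mul]
      rw [sum_comm]
      refine sum_congr rfl fun j hj => ?_
      rw [mem_range] at hj
      rw [ih (n - j) (by lia), mul_sum]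
      refine sum_subset_zero_on_sdiff (range_mono (by lia)) (fun i hi => ?_) fun i hi => ?_
      · rw [coeff_multisetSeries_pow_of_lt R (by simpa using (mem_sdiff.mp hi).2), mul_zero,
          zero_mul]
      · rw [mem_range] at hi
        rw [show n + 1 - (i + 1) = j + (n - j - i) by lia, pow_add]
        ring

/-- The coefficient of `b ^ k` in `n! * wordEnumerator t b n`, as a function of the size `b` of the
alphabet. -/
def stirlingWeight (n k : ℕ) : R :=
  n.stirlingFirst k *
    ∑ i ∈ range (k + 1), (k.stirlingSecond i : R) * i.factorial * (t - 1) ^ (n - i)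

theorem factorial_mul_wordEnumerator (b n : ℕ) :
    (n.factorial : R) * wordEnumerator t b n =
      ∑ k ∈ range (n + 1), (b : R) ^ k * stirlingWeight t n k := by
  simp_rw [wordEnumerator_eq_sum_coeff, mul_sum, ← mul_assoc,
    factorial_mul_coeff_multisetSeries_pow, sum_mul]
  rw [sum_comm]
  refine sum_congr rfl fun k hk => ?_
  simp_rw [stirlingWeight, mul_assoc]
  rw [← sum_stirlingSecond_mul_of_le (mem_range_succ_iff.mp hk), mul_sum, mul_sum]
  refine sum_congr rfl fun i _ => ?_
  push_cast
  ring

/-- The weak descent enumerator, evaluated at `t`, of the surjective words of length `n` over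
`Fin m`, that is, of the Cayley permutations of `[n]` with image `[m]`. -/
def surjEnumerator (m n : ℕ) : R :=
  ∑ w : Fin n → Fin m with Surjective w, t ^ wordDes w

theorem wordEnumerator_eq_sum_surjEnumerator (b n : ℕ) :
    wordEnumerator t b n = ∑ m ∈ range (b + 1), b.choose m • surjEnumerator t m n :=
  sum_words_eq_sum_choose_nsmul (f := fun _ w => t ^ wordDes w)
    (fun _ _ e w => by rw [wordDes_comp e w]) b

theorem factorial_mul_surjEnumerator (m n : ℕ) :
    (n.factorial : R) * surjEnumerator t m n =
      ∑ k ∈ range (n + 1), ((m.factorial * k.stirlingSecond m : ℕ) : R) * stirlingWeight t n k := by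
  revert m
  refine eq_of_sum_choose_nsmul_eq fun b => ?_
  simp_rw [← mul_smul_comm]
  rw [← mul_sum, ← wordEnumerator_eq_sum_surjEnumerator, factorial_mul_wordEnumerator]
  simp_rw [smul_sum]
  rw [sum_comm]
  refine sum_congr rfl fun k _ => ?_
  rw [← Nat.cast_pow, ← sum_choose_mul_factorial_mul_stirlingSecond b k, Nat.cast_sum, sum_mul]
  exact sum_congr rfl fun m _ => by rw [Nat.cast_mul, mul_assoc, nsmul_eq_mul]

theorem sum_cay_eq_sum_surjEnumerator (n : ℕ) :
    ∑ w ∈ cay n, t ^ des w = ∑ m ∈ range (n + 1), surjEnumerator t m n := by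
  have card_initial {m : ℕ} (hm : m ∈ range (n + 1)) : #{j : Fin n | j.val < m} = m := by
    rw [Fin.card_filter_val_lt, min_eq_right (mem_range_succ_iff.mp hm)]
  have cay_eq : cay n = (range (n + 1)).biUnion fun m =>
      {w : Fin n → Fin n | univ.image w = ({j : Fin n | j.val < m} : Finset (Fin n))} := by
    ext w
    simp [cay, IsCayley]
  rw [cay_eq, sum_biUnion]
  · refine sum_congr rfl fun m hm => ?_
    simp_rw [des_eq_wordDes]
    rw [sum_image_eq_sum_surjective (f := fun _ w => t ^ wordDes w)
      (fun _ _ e w => by rw [wordDes_comp e w]), card_initial hm, surjEnumerator]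
  · intro m hm l hl hml
    refine disjoint_filter.mpr fun w _ hwm hwl => hml ?_
    rw [← card_initial hm, ← card_initial hl, ← hwm, ← hwl]

end CaylerianEnumerator

end Caylerian

open Caylerian Finset in
theorem mainTheorem1_general {R : Type*} [CommRing R] (t : R) (n : ℕ) :
    (n.factorial : R) * ∑ w ∈ cay n, t ^ des w =
      ∑ k ∈ range (n + 1), (n.stirlingFirst k : R) * fub k *
        ∑ i ∈ range (k + 1), (k.stirlingSecond i : R) * i.factorial * (t - 1) ^ (n - i) := by
  rw [sum_cay_eq_sum_surjEnumerator, mul_sum]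
  simp_rw [factorial_mul_surjEnumerator]
  rw [sum_comm]
  refine sum_congr rfl fun k hk => ?_
  rw [← sum_mul, ← Nat.cast_sum, sum_factorial_mul_stirlingSecond_eq_fub (mem_range_succ_iff.mp hk),
    stirlingWeight]
  ring

/-- Here `Nat.stirlingFirst` and `Nat.stirlingSecond` are the unsigned Stirling numbers of the first
kind and the Stirling numbers of the second kind. -/
theorem mainTheorem1 (n : ℕ) :
    Caylerian.caylerianPoly n =
      Polynomial.C (1 / (n.factorial : ℚ)) *
        ∑ k ∈ Finset.range (n + 1),
          (Nat.stirlingFirst n k : Polynomial ℚ) * (Caylerian.fub k : Polynomial ℚ) *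
            ∑ i ∈ Finset.range (k + 1),
              (Nat.stirlingSecond k i : Polynomial ℚ) * (i.factorial : Polynomial ℚ) *
                (Polynomial.X - 1) ^ (n - i) := by
  rw [← mainTheorem1_general, ← mul_assoc, ← Polynomial.C_eq_natCast, ← Polynomial.C_mul,
    one_div_mul_cancel (by positivity), Polynomial.C_1, one_mul, Caylerian.caylerianPoly]
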